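/- **Setting.** An instance of the minimum spanning tree (MST) problem under explorable uncertainty with predictions consists of a finite connected multigraph $G=(V,E)$ and, for each edge $e\in E$, an uncertainty interval $I_e$ and a predicted value $\hat w_e\in I_e$. Each $I_e$ is either open, $I_e=(L_e,U_e)$ with $L_e<U_e$ ($e$ is *non-trivial*), or a single point, $I_e=\{w_e\}$ with $L_e=U_e=w_e$ ($e$ is *trivial*). The true weights $w_e\in I_e$ are unknown; querying $e$ reveals $w_e$. A (deterministic) algorithm is given $G$, the intervals and the predictions, and makes finitely many queries sequentially, where each decision may depend on the answers received so far. A set $Q\subseteq E$ is *feasible* if some $T\subseteq E$ is an MST for the true values $w_e$, $e\in Q$, and every combination of weights from $I_e$ for $e\in E\setminus Q$; a feasible set of minimum cardinality is *optimal*. An edge is *mandatory* if it belongs to every feasible set, and *prediction mandatory* if this holds under the assumption that the true weights equal the predictions. An instance is *prediction mandatory free* if it has no prediction mandatory edge. After a set of edges has been queried, the *remaining instance* is the one in which each queried edge is trivial, with its true weight as its only possible and as its predicted value. For distinct $e,e'\in E$ let $k_{e'}(e)=0$ if the relation of $w_e$ to $I_{e'}$ predicted by $\hat w_e$ is true, and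 $k_{e'}(e)=1$ otherwise; here $\hat w_e$ predicts that $w_e\le L_{e'}$ if $\hat w_e\le L_{e'}$, that $w_e\ge U_{e'}$ if $\hat w_e\ge U_{e'}$, and that $L_{e'}<w_e<U_{e'}$ if $L_{e'}<\hat w_e<U_{e'}$. For $F\subseteq E$ put $$k^+(F)=\sum_{e\in F}\ \sum_{e'\in E\setminus\{e\}}k_{e'}(e),\qquad k^-(F)=\sum_{e\in F}\ \sum_{e'\in E\setminus\{e\}}k_{e}(e').$$ **Theorem.** For every integer $\gamma\ge 2$ there is an algorithm such that for every instance and all true weights the following holds for the set $\mathrm{ALG}\subseteq E$ of edges that it queries. The instance remaining after the queries is prediction mandatory free, and there is a set $D\subseteq E\setminus \mathrm{ALG}$ of unqueried non-trivial edges, each of which can be deleted or contracted in the remaining instance (that is, each $e\in D$ satisfies $L_e\ge U_{e'}$ for all other edges $e'$ of some cycle through $e$, or $U_e\le L_{e'}$ for all other edges $e'$ of some cut containing $e$, with the limits of the remaining instance), such that for every optimal query set $\mathrm{OPT}$ of the given instance $$|\mathrm{ALG}|\le\min\Bigl\{\bigl(1+\tfrac1\gamma\bigr)\bigl(|(\mathrm{ALG}\cup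 D)\cap \mathrm{OPT}|+k^+(\mathrm{ALG})+k^-(\mathrm{ALG})\bigr),\ \gamma\,|(\mathrm{ALG}\cup D)\cap \mathrm{OPT}|+\gamma-2\Bigr\}.$$ -/

import Mathlib

universe u v

namespace MSTUncertainty

/-- The uncertainty interval with lower limit `L` and upper limit `U`: the open interval `(L, U)`,
or the one-point set `{L}` if `L = U` (a trivial edge, whose weight is known). -/
def uncertaintyInterval (L U : ℝ) : Set ℝ :=
  {x | (L < x ∧ x < U) ∨ (L = U ∧ x = L)}

/-- `u` and `v` are the ends of a walk in the multigraph `G` that uses only edges from `S`. -/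
def Linked {V E : Type*} (G : Graph V E) (S : Set E) (u v : V) : Prop :=
  Relation.ReflTransGen (fun x y => ∃ e ∈ S, G.IsLink e x y) u v

/-- The edge `e` lies on a cycle of `G` all of whose other edges belong to `S`: the ends of `e` are
linked by edges of `S` other than `e` (a walk between the ends that avoids `e` contains a simple
path, which `e` closes to a cycle; a loop is a cycle by itself). -/
def ClosesCycle {V E : Type*} (G : Graph V E) (S : Set E) (e : E) : Prop :=
  ∃ u v, G.IsLink e u v ∧ Linked G (S \ {e}) u v

/-- The edge `e` belongs to the cut between `X` and the complement of `X`. -/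
def Crosses {V E : Type*} (G : Graph V E) (X : Set V) (e : E) : Prop :=
  ∃ u v, G.IsLink e u v ∧ u ∈ X ∧ v ∉ X

/-- `T` is (the edge set of) a spanning tree: it connects all vertices and contains no cycle. -/
def IsSpanningTree {V E : Type*} (G : Graph V E) (T : Finset E) : Prop :=
  (∀ u v : V, Linked G T u v) ∧ ∀ e ∈ T, ¬ ClosesCycle G T e

/-- `T` is a minimum spanning tree for the edge weights `w`. -/
def IsMST {V E : Type*} (G : Graph V E) (w : E → ℝ) (T : Finset E) : Prop :=
  IsSpanningTree G T ∧ ∀ T', IsSpanningTree G T' → ∑ e ∈ T, w e ≤ ∑ e ∈ T', w e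

/-- What an algorithm is given: a connected multigraph with vertex set `V` and edge set `E`, an
uncertainty interval for every edge, and a predicted value in the interval of every edge. -/
structure Instance (V E : Type*) where
  graph : Graph V E
  vertexSet_eq : graph.vertexSet = Set.univ
  edgeSet_eq : graph.edgeSet = Set.univ
  connected : ∀ u v : V, Linked graph Set.univ u v
  lower : E → ℝ
  upper : E → ℝ
  lower_le_upper : ∀ e, lower e ≤ upper e
  pred : E → ℝ
  pred_mem : ∀ e, pred e ∈ uncertaintyInterval (lower e) (upper e)

namespace Instance

variable {V E : Type*}

/-- The set `I_e` of possible weights of the edge `e`. -/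
def interval (G : Instance V E) (e : E) : Set ℝ :=
  uncertaintyInterval (G.lower e) (G.upper e)

/-- `w` is a possible assignment of true edge weights. -/
def IsRealization (G : Instance V E) (w : E → ℝ) : Prop :=
  ∀ e, w e ∈ G.interval e

/-- The query set `Q` is feasible for the true weights `w`: some `T` is an MST for the true values
on `Q` and every possible combination of weights of the unqueried edges. -/
def Feasible (G : Instance V E) (w : E → ℝ) (Q : Finset E) : Prop :=
  ∃ T : Finset E, ∀ w' : E → ℝ, G.IsRealization w' → (∀ e ∈ Q, w' e = w e) → IsMST G.graph w' T

/-- `Q` is an optimal query set: a feasible one of minimum cardinality. -/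
def IsOptimal (G : Instance V E) (w : E → ℝ) (Q : Finset E) : Prop :=
  G.Feasible w Q ∧ ∀ Q', G.Feasible w Q' → Q.card ≤ Q'.card

/-- An edge is mandatory (for the true weights `w`) if every feasible query set contains it. -/
def Mandatory (G : Instance V E) (w : E → ℝ) (e : E) : Prop :=
  ∀ Q, G.Feasible w Q → e ∈ Q

/-- An edge is prediction mandatory if it is mandatory when the predictions are the true weights. -/
def PredictionMandatory (G : Instance V E) (e : E) : Prop :=
  G.Mandatory G.pred e

/-- No edge is prediction mandatory. -/
def PredictionMandatoryFree (G : Instance V E) : Prop :=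
  ∀ e, ¬ G.PredictionMandatory e

/-- The instance that remains once the edges of `Q` have been queried with answers `w`: the queried
edges are trivial now, with their true weights. -/
def afterQueries [DecidableEq E] (G : Instance V E) (w : E → ℝ) (Q : Finset E) :
    Instance V E where
  graph := G.graph
  vertexSet_eq := G.vertexSet_eq
  edgeSet_eq := G.edgeSet_eq
  connected := G.connected
  lower e := if e ∈ Q then w e else G.lower e
  upper e := if e ∈ Q then w e else G.upper e
  lower_le_upper e := by
    by_cases h : e ∈ Q
    · simp [h]
    · simpa [h] using G.lower_le_upper e
  pred e := if e ∈ Q then w e else G.pred e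
  pred_mem e := by
    by_cases h : e ∈ Q
    · simp [h, uncertaintyInterval]
    · simpa [h] using G.pred_mem e

/-- The edge `e` has maximum weight on some cycle, for all possible weights. -/
def ProvenMaximalOnCycle (G : Instance V E) (e : E) : Prop :=
  ClosesCycle G.graph {e' | G.upper e' ≤ G.lower e} e

/-- The edge `e` has minimum weight in some cut, for all possible weights. -/
def ProvenMinimalInCut (G : Instance V E) (e : E) : Prop :=
  ∃ X : Set V, Crosses G.graph X e ∧
    ∀ e', e' ≠ e → Crosses G.graph X e' → G.upper e ≤ G.lower e'

/-- The non-trivial edge `e` can be deleted from or contracted in the instance. As `e` is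
non-trivial, its weight is then strictly extremal on the cycle or in the cut, so `e` is in no MST
at all, respectively in every MST. -/
def Eliminated (G : Instance V E) (e : E) : Prop :=
  G.lower e < G.upper e ∧ (G.ProvenMaximalOnCycle e ∨ G.ProvenMinimalInCut e)

/-- The relation of the true weight of `e` to the interval of `e'` (left of it, right of it, or
contained in it) is as predicted by the predicted weight of `e`. -/
def RelationCorrect (G : Instance V E) (w : E → ℝ) (e' e : E) : Prop :=
  (G.pred e ≤ G.lower e' → w e ≤ G.lower e') ∧
  (G.upper e' ≤ G.pred e → G.upper e' ≤ w e) ∧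
  (G.lower e' < G.pred e ∧ G.pred e < G.upper e' → G.lower e' < w e ∧ w e < G.upper e')

open Classical in
/-- `k_{e'}(e)`. -/
noncomputable def hop (G : Instance V E) (w : E → ℝ) (e' e : E) : ℕ :=
  if G.RelationCorrect w e' e then 0 else 1

/-- `k⁺(e) = ∑_{e' ≠ e} k_{e'}(e)`. -/
noncomputable def kPlus [Fintype E] [DecidableEq E] (G : Instance V E) (w : E → ℝ) (e : E) : ℕ :=
  ∑ e' ∈ Finset.univ.erase e, G.hop w e' e

/-- `k⁻(e) = ∑_{e' ≠ e} k_{e}(e')`. -/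
noncomputable def kMinus [Fintype E] [DecidableEq E] (G : Instance V E) (w : E → ℝ) (e : E) : ℕ :=
  ∑ e' ∈ Finset.univ.erase e, G.hop w e e'

end Instance

/-- A deterministic adaptive strategy: halt, or query an edge `e` and continue depending on the
weight that is revealed. Every run of a strategy is finite. -/
inductive Strategy (E : Type*) where
  | halt : Strategy E
  | query (e : E) (next : ℝ → Strategy E) : Strategy E

/-- The set of edges queried by a strategy when the true weights are `w`. -/
def Strategy.queried {E : Type*} [DecidableEq E] : Strategy E → (E → ℝ) → Finset E
  | .halt, _ => ∅
  | .query e next, w => insert e ((next (w e)).queried w)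

/-- A deterministic query algorithm: from the instance (but not the true weights) it determines the
strategy that it follows. -/
def QueryAlgorithm : Type (max (u + 1) (v + 1)) :=
  ∀ (V : Type u) (E : Type v) [Finite V] [Fintype E] [DecidableEq E], Instance V E → Strategy E

end MSTUncertainty

/-!
Whether an edge `e` belongs to a minimum spanning tree is decided by comparing its weight with the
bottleneck weight between its ends in the graph without `e`. So `e` is mandatory if that bottleneck
lies strictly between the limits of `e` (`ThresholdInside`, `ThresholdInside.mem_of_feasible`), and
a cycle and a cut through `e` witness this. Everything below is expressed through such cycles and
cuts, so that each argument has a dual one.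

Take the spanning tree that is minimum for the lexicographic order by lower and then upper limits.
Either some edge is mandatory whatever the true weights are, or the tree is minimum both for the
lower and for the upper limits (`exists_knownMandatory_or_stable`). In the latter case there are
*pivots* `a`, `b`: the edge `a` is mandatory as soon as the weight of `b` lies in the interval of
`a`, so that every feasible set contains `a` or `b`. A tree edge `a` of largest upper limit on the
fundamental cycle of `b` gives a pivot if the intervals overlap, and so does a non-tree edge `a` of
smallest lower limit in the fundamental cut of `b`. If no pivot is predicted to make its edge `a`
mandatory, then the tree is certified under the predictions without any single edge, and the
instance is prediction mandatory free (`exists_knownMandatory_or_pivot`).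

The algorithm queries edges that are mandatory in any case, and otherwise `a` for a pivot with the
predicted weight of `b` in the interval of `a`. Such an `a` is in the optimal set, or the position
of `b` relative to `a` has been mispredicted, so these queries cost nothing in the consistency
bound. For the robustness bound, after `γ - 2` free queries of this kind comes a round
(`Pivot.wins_of_continuable`) which queries `a` and is continued according to the answer.
* A new edge is mandatory in any case: it is queried, and both queries are optimal or mispredicted.
* The edge `b` can be deleted or contracted: then `a`, or else the eliminated edge `b`, is optimal.
* There is a new pivot `a'`, `b`: then `b` is queried. If its weight is outside the interval of `a`,
  both `a` and `b` are mispredicted, and one of them is optimal. Otherwise `a` is optimal, `a'` is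
  queried too, and `a'` or `b` is optimal as well: two of three queries.

Only in the last case is a query neither optimal nor mispredicted. It then belongs to a batch of
`γ + 1` queries, the other `γ` of which pay for it, and two optimal edges pay for the batch in the
robustness bound.
-/

namespace MSTUncertainty

/-! ### Walks, cycles and cuts of a spanning tree -/

section Graphs

variable {V E : Type*} {G : Graph V E} {S S' : Set E} {u v x : V} {e f g : E} {X : Set V}

theorem Linked.mono (h : S ⊆ S') (huv : Linked G S u v) : Linked G S' u v :=
  huv.lift id fun _ _ ⟨e, he, hl⟩ => ⟨e, h he, hl⟩

theorem Linked.refl (u : V) : Linked G S u u := Relation.ReflTransGen.refl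

theorem Linked.trans (h : Linked G S u v) (h' : Linked G S v x) : Linked G S u x :=
  Relation.ReflTransGen.trans h h'

theorem Linked.symm (h : Linked G S u v) : Linked G S v u :=
  (Relation.ReflTransGen.swap _ _ h).lift id fun _ _ ⟨e, he, hl⟩ => ⟨e, he, hl.symm⟩

theorem linked_of_isLink (he : e ∈ S) (h : G.IsLink e u v) : Linked G S u v :=
  Relation.ReflTransGen.single ⟨e, he, h⟩

/-- If every edge of `S` can be bypassed in `S'`, then `S'` links whatever `S` links. -/
theorem Linked.of_forall (H : ∀ e ∈ S, ∀ x y, G.IsLink e x y → Linked G S' x y)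
    (h : Linked G S u v) : Linked G S' u v := by
  induction h with
  | refl => exact Linked.refl _
  | tail _ hs ih =>
    obtain ⟨e, he, hl⟩ := hs
    exact ih.trans (H e he _ _ hl)

/-- A walk can be shortened so that it uses the edge `e` at most once. -/
theorem Linked.split (e : E) (h : Linked G S u v) :
    Linked G (S \ {e}) u v ∨
      ∃ x y, G.IsLink e x y ∧ Linked G (S \ {e}) u x ∧ Linked G (S \ {e}) y v := by
  induction h using Relation.ReflTransGen.head_induction_on with
  | refl => exact .inl (Linked.refl _)
  | @head a c hs _ ih =>
    obtain ⟨g, hg, hl⟩ := hs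
    by_cases hge : g = e
    · subst hge
      rcases ih with ih | ⟨x, y, hxy, h1, h2⟩
      · exact .inr ⟨a, c, hl, Linked.refl _, ih⟩
      · rcases hl.eq_and_eq_or_eq_and_eq hxy with ⟨rfl, rfl⟩ | ⟨rfl, rfl⟩
        · exact .inr ⟨a, c, hl, Linked.refl _, h2⟩
        · exact .inl h2
    · have hstep : Linked G (S \ {e}) a c := linked_of_isLink ⟨hg, hge⟩ hl
      rcases ih with ih | ⟨x, y, hxy, h1, h2⟩
      · exact .inl (hstep.trans ih)
      · exact .inr ⟨x, y, hxy, hstep.trans h1, h2⟩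

theorem Linked.exists_crosses (h : Linked G S u v) (hu : u ∈ X) (hv : v ∉ X) :
    ∃ g ∈ S, Crosses G X g := by
  induction h using Relation.ReflTransGen.head_induction_on with
  | refl => exact absurd hu hv
  | @head a c hs _ ih =>
    obtain ⟨g, hg, hl⟩ := hs
    by_cases hc : c ∈ X
    · exact ih hc
    · exact ⟨g, hg, a, c, hl, hu, hc⟩

theorem ClosesCycle.mono (h : S ⊆ S') (he : ClosesCycle G S e) : ClosesCycle G S' e := by
  obtain ⟨u, v, hl, huv⟩ := he
  exact ⟨u, v, hl, huv.mono (Set.sdiff_subset_sdiff_left h)⟩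

/-- A cycle through `e` meets every cut containing `e` in a second edge. -/
theorem ClosesCycle.exists_crosses (h : ClosesCycle G S e) (hX : Crosses G X e) :
    ∃ g ∈ S, g ≠ e ∧ Crosses G X g := by
  obtain ⟨u, v, hl, huv⟩ := h
  obtain ⟨x, y, hxy, hx, hy⟩ := hX
  have : Linked G (S \ {e}) x y := by
    rcases hl.eq_and_eq_or_eq_and_eq hxy with ⟨rfl, rfl⟩ | ⟨rfl, rfl⟩
    · exact huv
    · exact huv.symm
  obtain ⟨g, hg, hc⟩ := this.exists_crosses hx hy
  exact ⟨g, hg.1, hg.2, hc⟩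

/-- The tree edge `e ∈ T` lies on the fundamental cycle of the non-tree edge `f`; equivalently,
`f` lies in the fundamental cut of `e`. -/
def OnCycle (G : Graph V E) (T : Finset E) (e f : E) : Prop :=
  e ∈ T ∧ f ∉ T ∧ ∃ u v, G.IsLink f u v ∧ ¬ Linked G (T \ {e}) u v

variable {T T' : Finset E}

/-- A walk of minimal edge set within a tree only uses edges whose removal disconnects its ends. -/
theorem IsSpanningTree.linked_needed (hT : IsSpanningTree G T) (u v : V) :
    Linked G {e | e ∈ T ∧ ¬ Linked G (T \ {e}) u v} u v := by
  classical
  obtain ⟨P, hP⟩ := exists_minimal_of_wellFoundedLT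
    (fun P : Finset E => P ⊆ T ∧ Linked G P u v) ⟨T, subset_rfl, hT.1 u v⟩
  refine hP.prop.2.mono fun e he => ⟨hP.prop.1 he, fun hlk => ?_⟩
  rcases hP.prop.2.split e with h | ⟨x, y, hxy, h1, h2⟩
  · have := hP.le_of_le (y := P.erase e)
      ⟨(Finset.erase_subset _ _).trans hP.prop.1, by simpa using h⟩ (Finset.erase_subset _ _)
    exact Finset.notMem_erase e P (this he)
  · have hsub : (P : Set E) \ {e} ⊆ T \ {e} :=
      Set.sdiff_subset_sdiff_left (by exact_mod_cast hP.prop.1)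
    exact hT.2 e (hP.prop.1 he) ⟨x, y, hxy,
      ((h1.mono hsub).symm.trans hlk).trans (h2.mono hsub).symm⟩

/-- The fundamental cycle of a non-tree edge. -/
theorem IsSpanningTree.closesCycle (hT : IsSpanningTree G T) (hl : G.IsLink f u v) (hf : f ∉ T) :
    ClosesCycle G {e | OnCycle G T e f} f :=
  ⟨u, v, hl, (hT.linked_needed u v).mono fun _ he =>
    ⟨⟨he.1, hf, u, v, hl, he.2⟩, fun h => hf (h ▸ he.1)⟩⟩

/-- The fundamental cycle of `f`, seen from one of its tree edges `e`. -/
theorem IsSpanningTree.closesCycle_of_onCycle (hT : IsSpanningTree G T) (h : OnCycle G T e f) :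
    ClosesCycle G {g | OnCycle G T g f ∨ g = f} e := by
  obtain ⟨he, hf, u, v, hl, hn⟩ := h
  have hef : f ≠ e := fun h => hf (h ▸ he)
  have hsub : {g | g ∈ T ∧ ¬ Linked G (T \ {g}) u v} \ {e} ⊆
      {g | OnCycle G T g f ∨ g = f} \ {e} :=
    Set.sdiff_subset_sdiff_left fun g hg => .inl ⟨hg.1, hf, u, v, hl, hg.2⟩
  rcases (hT.linked_needed u v).split e with h | ⟨x, y, hxy, h1, h2⟩
  · exact absurd (h.mono (Set.sdiff_subset_sdiff_left fun g hg => hg.1)) hn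
  · exact ⟨x, y, hxy, ((h1.mono hsub).symm.trans (linked_of_isLink ⟨.inr rfl, hef⟩ hl)).trans
      (h2.mono hsub).symm⟩

/-- Only edges of the fundamental cut of `e` and `e` itself leave a component of `T \ {e}`. -/
theorem onCycle_of_crosses (he : e ∈ T) (hc : Crosses G {x | Linked G (T \ {e}) u x} g)
    (hg : g ≠ e) : OnCycle G T e g := by
  obtain ⟨x, y, hl, hx, hy⟩ := hc
  refine ⟨he, fun hgT => hy (Linked.trans hx (linked_of_isLink ⟨hgT, hg⟩ hl)), x, y, hl,
    fun h => hy (Linked.trans hx h)⟩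

/-- The fundamental cut of a tree edge. -/
theorem IsSpanningTree.exists_cut (hT : IsSpanningTree G T) (hl : G.IsLink e u v) (he : e ∈ T) :
    ∃ X, Crosses G X e ∧ ∀ g, g ≠ e → Crosses G X g → OnCycle G T e g :=
  ⟨{x | Linked G (T \ {e}) u x}, ⟨u, v, hl, Linked.refl u, fun h => hT.2 e he ⟨u, v, hl, h⟩⟩,
    fun _ hg hc => onCycle_of_crosses he hc hg⟩

/-- The fundamental cut of `e`, seen from one of its non-tree edges `f`. -/
theorem OnCycle.exists_cut (h : OnCycle G T e f) :
    ∃ X, Crosses G X f ∧ ∀ g, Crosses G X g → g = e ∨ OnCycle G T e g := by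
  obtain ⟨he, hf, u, v, hl, hn⟩ := h
  refine ⟨{x | Linked G (T \ {e}) u x}, ⟨u, v, hl, Linked.refl u, hn⟩, fun g hc => ?_⟩
  by_cases hg : g = e
  · exact .inl hg
  · exact .inr (onCycle_of_crosses he hc hg)

section Exchange

variable [DecidableEq E]

/-- Exchanging `e` for an edge `f` that reconnects the tree yields a spanning tree. -/
theorem IsSpanningTree.exchange (hT : IsSpanningTree G T) (he : e ∈ T) (hl : G.IsLink f u v)
    (hn : ¬ Linked G (T \ {e}) u v) : IsSpanningTree G (insert f (T.erase e)) := by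
  have hsub : (T : Set E) \ {e} ⊆ ((insert f (T.erase e) : Finset E) : Set E) := by
    intro g hg; simp at hg ⊢; tauto
  have hfl : Linked G ((insert f (T.erase e) : Finset E) : Set E) u v :=
    linked_of_isLink (by simp) hl
  constructor
  · intro a b
    refine (hT.1 a b).of_forall fun g hg x y hxy => ?_
    by_cases hge : g = e
    · subst hge
      rcases (hT.1 u v).split g with h | ⟨x', y', hxy', h1, h2⟩
      · exact absurd h hn
      · have : Linked G ((insert f (T.erase g) : Finset E) : Set E) x' y' :=
          ((h1.mono hsub).symm.trans hfl).trans (h2.mono hsub).symm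
        rcases hxy.eq_and_eq_or_eq_and_eq hxy' with ⟨rfl, rfl⟩ | ⟨rfl, rfl⟩
        · exact this
        · exact this.symm
    · exact linked_of_isLink (hsub ⟨hg, hge⟩) hxy
  · rintro h hh ⟨r, s, hrs, hlk⟩
    by_cases hhf : h = f
    · subst hhf
      have hlk' : Linked G (T \ {e}) r s := hlk.mono (by intro g hg; simp at hg ⊢; tauto)
      rcases hl.eq_and_eq_or_eq_and_eq hrs with ⟨rfl, rfl⟩ | ⟨rfl, rfl⟩
      · exact hn hlk'
      · exact hn hlk'.symm
    · have hhT : h ∈ T ∧ h ≠ e := by simp at hh; tauto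
      rcases hlk.split f with h0 | ⟨p, q, hpq, h1, h2⟩
      · exact hT.2 h hhT.1 ⟨r, s, hrs, h0.mono (by intro g hg; simp at hg ⊢; tauto)⟩
      -- A cycle of the new tree through `h` and `f` bypasses `f` through `h`, within `T \ {e}`.
      · have hs : (((insert f (T.erase e) : Finset E) : Set E) \ {h}) \ {f} ⊆
            (T : Set E) \ {e} := by
          intro g hg; simp at hg ⊢; tauto
        have hlk' : Linked G (T \ {e}) p q :=
          ((h1.mono hs).symm.trans (linked_of_isLink hhT hrs)).trans (h2.mono hs).symm
        rcases hl.eq_and_eq_or_eq_and_eq hpq with ⟨rfl, rfl⟩ | ⟨rfl, rfl⟩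
        · exact hn hlk'
        · exact hn hlk'.symm

/-- A tree edge can be exchanged for another edge of any cycle through it. -/
theorem IsSpanningTree.exists_exchange_of_closesCycle (hT : IsSpanningTree G T) (he : e ∈ T)
    (hc : ClosesCycle G S e) :
    ∃ g ∈ S, g ∉ T ∧ IsSpanningTree G (insert g (T.erase e)) := by
  obtain ⟨u, v, hl, -⟩ := id hc
  obtain ⟨X, hX, hcut⟩ := hT.exists_cut hl he
  obtain ⟨g, hg, hge, hgX⟩ := hc.exists_crosses hX
  obtain ⟨-, hgT, x, y, hxy, hn⟩ := hcut g hge hgX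
  exact ⟨g, hg, hgT, hT.exchange he hxy hn⟩

/-- A non-tree edge can be exchanged for a tree edge of any cut through it. -/
theorem IsSpanningTree.exists_exchange_of_crosses (hT : IsSpanningTree G T) (hf : f ∉ T)
    (hX : Crosses G X f) :
    ∃ g ∈ T, Crosses G X g ∧ IsSpanningTree G (insert f (T.erase g)) := by
  obtain ⟨u, v, hl, -⟩ := id hX
  obtain ⟨g, ⟨hg, hgf, x, y, hxy, hn⟩, -, hgX⟩ := (hT.closesCycle hl hf).exists_crosses hX
  exact ⟨g, hg, hgX, hT.exchange hg hxy hn⟩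

theorem sum_exchange (w : E → ℝ) (he : e ∈ T) (hf : f ∉ T) :
    ∑ g ∈ insert f (T.erase e), w g = ∑ g ∈ T, w g - w e + w f := by
  rw [Finset.sum_insert (by simp [hf]), ← Finset.add_sum_erase T w he]
  ring

/-- A spanning tree is minimum if no edge on the fundamental cycle of a non-tree edge is heavier
than that edge. -/
theorem IsSpanningTree.isMST (hT : IsSpanningTree G T) (hE : ∀ e, ∃ u v, G.IsLink e u v)
    {w : E → ℝ} (h : ∀ e f, OnCycle G T e f → w e ≤ w f) : IsMST G w T := by
  refine ⟨hT, ?_⟩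
  suffices ∀ n : ℕ, ∀ T', IsSpanningTree G T' → (T' \ T).card = n →
      ∑ e ∈ T, w e ≤ ∑ e ∈ T', w e from fun T' hT' => this _ T' hT' rfl
  intro n
  induction n with
  | zero =>
    intro T' hT' hn
    have hsub : T' ⊆ T := by simpa using hn
    suffices T = T' by rw [this]
    refine Finset.Subset.antisymm (fun e he => ?_) hsub
    by_contra heT'
    obtain ⟨u, v, hl⟩ := hE e
    exact hT.2 e he ⟨u, v, hl, (hT'.1 u v).mono fun g hg =>
      ⟨hsub hg, fun hge => heT' (by simpa [← show g = e from hge] using hg)⟩⟩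
  | succ n ih =>
    intro T' hT' hn
    obtain ⟨f, hf⟩ : (T' \ T).Nonempty := by rw [← Finset.card_pos]; omega
    have hf' := Finset.mem_sdiff.1 hf
    obtain ⟨u, v, hl⟩ := hE f
    obtain ⟨g, hgf, hgT', hT''⟩ :=
      hT'.exists_exchange_of_closesCycle hf'.1 (hT.closesCycle hl hf'.2)
    have hcard : (insert g (T'.erase f) \ T).card = n := by
      rw [Finset.insert_sdiff_of_mem _ hgf.1, Finset.erase_sdiff_comm, Finset.card_erase_of_mem hf,
        hn]
      rfl
    have h1 := ih _ hT'' hcard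
    rw [sum_exchange w hf'.1 hgT'] at h1
    linarith [h g f hgf]

end Exchange

theorem exists_isSpanningTree [Finite E] (h : ∀ u v, Linked G Set.univ u v) :
    ∃ T : Finset E, IsSpanningTree G T := by
  classical
  have := Fintype.ofFinite E
  obtain ⟨T, hT⟩ := exists_minimal_of_wellFoundedLT
    (fun T : Finset E => ∀ u v, Linked G T u v) ⟨Finset.univ, by simpa using h⟩
  refine ⟨T, hT.prop, fun e he ⟨u, v, hl, huv⟩ => ?_⟩
  have := hT.le_of_le (y := T.erase e) (fun a b => (hT.prop a b).of_forall fun g hg x y hxy => ?_)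
    (Finset.erase_subset _ _)
  · exact Finset.notMem_erase e T (this he)
  · rw [Finset.coe_erase]
    by_cases hge : g = e
    · subst hge
      rcases hl.eq_and_eq_or_eq_and_eq hxy with ⟨rfl, rfl⟩ | ⟨rfl, rfl⟩
      · exact huv
      · exact huv.symm
    · exact linked_of_isLink ⟨hg, hge⟩ hxy

/-- The greedy tree for any linear preorder of the edges, here given by a key. -/
theorem exists_isSpanningTree_key_le [Finite E] {κ : Type*} [LinearOrder κ] (key : E → κ)
    (h : ∀ u v, Linked G Set.univ u v) :
    ∃ T : Finset E, IsSpanningTree G T ∧ ∀ e f, OnCycle G T e f → key e ≤ key f := by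
  classical
  have := Fintype.ofFinite E
  -- The rank turns the key into a real weight, so that a minimum spanning tree can be taken.
  let rank : E → ℝ := fun e => ((Finset.univ.filter fun g => key g < key e).card : ℝ)
  obtain ⟨T, hT, hmin⟩ := Finset.exists_min_image
    (Finset.univ.filter fun T : Finset E => IsSpanningTree G T) (fun T => ∑ e ∈ T, rank e)
    (by obtain ⟨T, hT⟩ := exists_isSpanningTree h; exact ⟨T, by simpa using hT⟩)
  simp only [Finset.mem_filter, Finset.mem_univ, true_and] at hT hmin
  refine ⟨T, hT, fun e f hef => ?_⟩
  obtain ⟨he, hf, u, v, hl, hn⟩ := hef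
  have h1 := hmin _ (hT.exchange he hl hn)
  rw [sum_exchange rank he hf] at h1
  by_contra! hlt
  have : rank f < rank e := by
    refine Nat.cast_lt.2 (Finset.card_lt_card ⟨fun g hg => ?_, fun hs => ?_⟩)
    · simp only [Finset.mem_filter, Finset.mem_univ, true_and] at hg ⊢
      exact hg.trans hlt
    · have := hs (Finset.mem_filter.2 ⟨Finset.mem_univ f, hlt⟩)
      simp at this
  linarith

end Graphs

/-! ### Limits of intervals -/

namespace Instance

variable {V E : Type*} {G : Instance V E} {w v : E → ℝ} {a b e f g : E} {T Q S S' : Finset E}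

theorem exists_isLink (G : Instance V E) (e : E) : ∃ u v, G.graph.IsLink e u v :=
  Graph.exists_isLink_of_mem_edgeSet (by rw [G.edgeSet_eq]; trivial)

theorem exists_isRealization (G : Instance V E) : ∃ w, G.IsRealization w :=
  ⟨G.pred, G.pred_mem⟩

theorem lower_le_of_mem {x : ℝ} (hx : x ∈ G.interval e) : G.lower e ≤ x := by
  rcases hx with h | h
  · exact h.1.le
  · exact h.2.ge

theorem le_upper_of_mem {x : ℝ} (hx : x ∈ G.interval e) : x ≤ G.upper e := by
  rcases hx with h | h
  · exact h.2.le
  · exact (h.2.trans h.1).le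

theorem lower_lt_of_mem {x : ℝ} (hx : x ∈ G.interval e) (h : G.lower e < G.upper e) :
    G.lower e < x := by
  rcases hx with h' | h'
  · exact h'.1
  · exact absurd h'.1 h.ne

theorem lt_upper_of_mem {x : ℝ} (hx : x ∈ G.interval e) (h : G.lower e < G.upper e) :
    x < G.upper e := by
  rcases hx with h' | h'
  · exact h'.2
  · exact absurd h'.1 h.ne

/-! ### The remaining instance -/

section AfterQueries

variable [DecidableEq E]

@[simp] theorem afterQueries_graph : (G.afterQueries w S).graph = G.graph := rfl

theorem afterQueries_lower : (G.afterQueries w S).lower e = if e ∈ S then w e else G.lower e := rfl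

theorem afterQueries_upper : (G.afterQueries w S).upper e = if e ∈ S then w e else G.upper e := rfl

theorem afterQueries_pred : (G.afterQueries w S).pred e = if e ∈ S then w e else G.pred e := rfl

theorem afterQueries_empty : G.afterQueries w ∅ = G := by
  simp [afterQueries]

theorem afterQueries_congr (h : ∀ e ∈ S, w e = v e) :
    G.afterQueries w S = G.afterQueries v S := by
  have (h' : E → ℝ) : (fun e => if e ∈ S then w e else h' e) =
      fun e => if e ∈ S then v e else h' e := by
    funext e
    split_ifs with he
    · exact h e he
    · rfl
  simp only [afterQueries, this]

theorem afterQueries_afterQueries :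
    (G.afterQueries w S).afterQueries w S' = G.afterQueries w (S ∪ S') := by
  have (h' : E → ℝ) : (fun e => if e ∈ S' then w e else if e ∈ S then w e else h' e) =
      fun e => if e ∈ S ∪ S' then w e else h' e := by
    funext e
    by_cases h1 : e ∈ S <;> by_cases h2 : e ∈ S' <;> simp [h1, h2]
  simp only [afterQueries, this]

theorem mem_interval_afterQueries {x : ℝ} :
    x ∈ (G.afterQueries w S).interval e ↔ if e ∈ S then x = w e else x ∈ G.interval e := by
  by_cases h : e ∈ S
  · simp only [interval, uncertaintyInterval, afterQueries, h, if_true, Set.mem_ofPred_eq]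
    constructor
    · rintro (h | h)
      · exact absurd (h.1.trans h.2) (lt_irrefl _)
      · exact h.2
    · exact fun h => .inr ⟨trivial, h⟩
  · simp [interval, afterQueries, h]

theorem IsRealization.afterQueries (hw : G.IsRealization w) :
    (G.afterQueries w S).IsRealization w := by
  intro e
  rw [mem_interval_afterQueries]
  split_ifs
  · rfl
  · exact hw e

theorem IsRealization.of_afterQueries (hw : G.IsRealization w)
    (hv : (G.afterQueries w S).IsRealization v) :
    G.IsRealization v ∧ ∀ e ∈ S, v e = w e := by
  have h (e) := mem_interval_afterQueries.1 (hv e)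
  refine ⟨fun e => ?_, fun e he => by simpa [he] using h e⟩
  have he := h e
  split_ifs at he with hS
  · rw [he]; exact hw e
  · exact he

theorem notMem_of_lower_lt (h : (G.afterQueries w S).lower e < (G.afterQueries w S).upper e) :
    e ∉ S ∧ G.lower e < G.upper e := by
  rw [afterQueries_lower, afterQueries_upper] at h
  split_ifs at h with hS
  · exact absurd h (lt_irrefl _)
  · exact ⟨hS, h⟩

theorem lower_le_afterQueries (hw : G.IsRealization w) :
    G.lower e ≤ (G.afterQueries w S).lower e := by
  rw [afterQueries_lower]
  split_ifs
  · exact lower_le_of_mem (hw e)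
  · exact le_rfl

theorem upper_afterQueries_le (hw : G.IsRealization w) :
    (G.afterQueries w S).upper e ≤ G.upper e := by
  rw [afterQueries_upper]
  split_ifs
  · exact le_upper_of_mem (hw e)
  · exact le_rfl

/-- An edge that can be deleted or contracted can still be so after further queries. -/
theorem Eliminated.afterQueries (hw : G.IsRealization w) (h : G.Eliminated e) (he : e ∉ S) :
    (G.afterQueries w S).Eliminated e := by
  obtain ⟨hlt, h⟩ := h
  have hL : (G.afterQueries w S).lower e = G.lower e := by simp [afterQueries_lower, he]
  have hU : (G.afterQueries w S).upper e = G.upper e := by simp [afterQueries_upper, he]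
  refine ⟨by rwa [hL, hU], ?_⟩
  rcases h with h | ⟨X, hX, hcut⟩
  · refine .inl (ClosesCycle.mono (fun g (hg : G.upper g ≤ G.lower e) => ?_) h)
    rw [Set.mem_ofPred_eq, hL]
    exact (upper_afterQueries_le hw).trans hg
  · refine .inr ⟨X, hX, fun g hg hgX => ?_⟩
    rw [hU]
    exact (hcut g hg hgX).trans (lower_le_afterQueries hw)

theorem Feasible.afterQueries (hw : G.IsRealization w) (hQ : G.Feasible w Q) :
    (G.afterQueries w S).Feasible w Q := by
  obtain ⟨T, hT⟩ := hQ
  exact ⟨T, fun w' hw' h => hT w' (hw.of_afterQueries hw').1 h⟩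

end AfterQueries

/-! ### Mandatory edges and pivots -/

/-- A sufficient condition for `e` to be mandatory: the threshold that decides whether `e` belongs
to a minimum spanning tree, that is, the bottleneck weight between the ends of `e` in the graph
without `e`, lies strictly between the limits of `e`. It is below the upper limit because of a
cycle, and above the lower limit because of a cut. -/
def ThresholdInside (G : Instance V E) (w : E → ℝ) (e : E) : Prop :=
  ClosesCycle G.graph {g | w g < G.upper e} e ∧
    ∃ X, Crosses G.graph X e ∧ ∀ g, g ≠ e → Crosses G.graph X g → G.lower e < w g

theorem ThresholdInside.lower_lt_upper (h : G.ThresholdInside w e) : G.lower e < G.upper e := by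
  obtain ⟨hc, X, hX, hcut⟩ := h
  obtain ⟨g, hg, hge, hgX⟩ := hc.exists_crosses hX
  exact (hcut g hge hgX).trans hg

/-- Whichever tree a query set without `e` certifies, there is a weight of `e`, just below the
upper or just above the lower limit, for which exchanging `e` improves that tree. -/
theorem ThresholdInside.mem_of_feasible [DecidableEq E] (h : G.ThresholdInside w e)
    (hw : G.IsRealization w) (hQ : G.Feasible w Q) : e ∈ Q := by
  by_contra heQ
  have hlt := h.lower_lt_upper
  obtain ⟨hc, X, hX, hcut⟩ := h
  obtain ⟨T, hT⟩ := hQ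
  have hMST : ∀ x, G.lower e < x → x < G.upper e → IsMST G.graph (Function.update w e x) T := by
    intro x h1 h2
    refine hT _ (fun g => ?_) fun g hg => Function.update_of_ne (by rintro rfl; exact heQ hg) _ _
    by_cases hge : g = e
    · subst hge; rw [Function.update_self]; exact .inl ⟨h1, h2⟩
    · rw [Function.update_of_ne hge]; exact hw g
  have hTree : IsSpanningTree G.graph T := (hT w hw fun _ _ => rfl).1
  by_cases heT : e ∈ T
  · obtain ⟨g, hg, hgT, hT'⟩ := hTree.exists_exchange_of_closesCycle heT hc
    obtain ⟨x, h1, h2⟩ := exists_between (max_lt hlt (show w g < G.upper e from hg))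
    have := (hMST x ((le_max_left _ _).trans_lt h1) h2).2 _ hT'
    rw [sum_exchange _ heT hgT, Function.update_self,
      Function.update_of_ne (by rintro rfl; exact hgT heT)] at this
    linarith [(le_max_right (G.lower e) (w g)).trans_lt h1]
  · obtain ⟨g, hgT, hgX, hT'⟩ := hTree.exists_exchange_of_crosses heT hX
    have hge : g ≠ e := by rintro rfl; exact heT hgT
    obtain ⟨x, h1, h2⟩ := exists_between (lt_min hlt (hcut g hge hgX))
    have := (hMST x h1 (h2.trans_le (min_le_left _ _))).2 _ hT'
    rw [sum_exchange _ hgT heT, Function.update_self, Function.update_of_ne hge] at this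
    linarith [h2.trans_le (min_le_right (G.upper e) (w g))]

theorem not_eliminated (hc : ClosesCycle G.graph {g | G.lower g < G.upper e} e) {X : Set V}
    (hX : Crosses G.graph X e) (hcut : ∀ g, g ≠ e → Crosses G.graph X g → G.lower e < G.upper g) :
    ¬ G.Eliminated e := by
  rintro ⟨-, h | ⟨Y, hY, h⟩⟩
  · obtain ⟨g, hg, hge, hgX⟩ := ClosesCycle.exists_crosses h hX
    exact absurd (hcut g hge hgX) (not_lt.2 hg)
  · obtain ⟨g, hg, hge, hgY⟩ := hc.exists_crosses hY
    exact absurd hg (not_lt.2 (h g hge hgY))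

theorem ThresholdInside.not_eliminated (h : G.ThresholdInside w e) (hw : G.IsRealization w) :
    ¬ G.Eliminated e := by
  obtain ⟨hc, X, hX, hcut⟩ := h
  exact Instance.not_eliminated (hc.mono fun g hg => (lower_le_of_mem (hw g)).trans_lt hg) hX
    fun g hg hgX => (hcut g hg hgX).trans_le (le_upper_of_mem (hw g))

theorem ThresholdInside.afterQueries [DecidableEq E] (h : G.ThresholdInside w e) (he : e ∉ S) :
    (G.afterQueries v S).ThresholdInside w e := by
  simpa [ThresholdInside, afterQueries_lower, afterQueries_upper, he] using h

/-- The edge `e` is mandatory whatever the true weights are. -/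
def KnownMandatory (G : Instance V E) (e : E) : Prop :=
  ∀ w, G.IsRealization w → G.ThresholdInside w e

/-- The edge `a` is mandatory as soon as the weight of `b` turns out to lie in the interval of `a`,
which is possible; hence at least one of `a` and `b` has to be queried. The last clause excludes
that `b` can be deleted or contracted. -/
structure Pivot (G : Instance V E) (a b : E) : Prop where
  ne : b ≠ a
  overlap : ∃ x ∈ G.interval b, G.lower a < x ∧ x < G.upper a
  inside : ∀ w, G.IsRealization w → G.lower a < w b → w b < G.upper a → G.ThresholdInside w a
  lower_lt_upper : G.lower b < G.upper b
  not_eliminated : ¬ G.Eliminated b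

theorem Pivot.exists_realization (h : G.Pivot a b) (hw : G.IsRealization w) :
    ∃ w', G.IsRealization w' ∧ (∀ e, e ≠ b → w' e = w e) ∧ G.ThresholdInside w' a := by
  classical
  obtain ⟨x, hx, h1, h2⟩ := h.overlap
  have hw' : G.IsRealization (Function.update w b x) := by
    intro g
    by_cases hg : g = b
    · subst hg; rwa [Function.update_self]
    · rw [Function.update_of_ne hg]; exact hw g
  exact ⟨_, hw', fun e he => Function.update_of_ne he _ _,
    h.inside _ hw' (by simpa using h1) (by simpa using h2)⟩

theorem Pivot.mem_or_mem [DecidableEq E] (h : G.Pivot a b) (hw : G.IsRealization w)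
    (hQ : G.Feasible w Q) : a ∈ Q ∨ b ∈ Q := by
  by_contra! hn
  obtain ⟨w', hw', heq, hin⟩ := h.exists_realization hw
  refine hn.1 (hin.mem_of_feasible hw' ?_)
  obtain ⟨T, hT⟩ := hQ
  exact ⟨T, fun w'' h1 h2 => hT w'' h1 fun e he =>
    (h2 e he).trans (heq e (by rintro rfl; exact hn.2 he))⟩

theorem Pivot.lower_lt_upper_left (h : G.Pivot a b) : G.lower a < G.upper a := by
  obtain ⟨x, -, h1, h2⟩ := h.overlap
  exact h1.trans h2

theorem Pivot.not_eliminated_left (h : G.Pivot a b) (hw : G.IsRealization w) :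
    ¬ G.Eliminated a := by
  obtain ⟨w', hw', -, hin⟩ := h.exists_realization hw
  exact hin.not_eliminated hw'

/-! ### Trees that are minimum for both limits -/

/-- A spanning tree that is minimum both for the lower and for the upper limits. -/
structure Stable (G : Instance V E) (T : Finset E) : Prop where
  tree : IsSpanningTree G.graph T
  lower_le : ∀ e f, OnCycle G.graph T e f → G.lower e ≤ G.lower f
  upper_le : ∀ e f, OnCycle G.graph T e f → G.upper e ≤ G.upper f

/-- The tree edge with largest upper limit on a fundamental cycle, and the non-tree edge closing
that cycle. -/
theorem Stable.pivot_of_cycle (hT : G.Stable T) (haf : OnCycle G.graph T a f)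
    (hmax : ∀ g, OnCycle G.graph T g f → G.upper g ≤ G.upper a) (hlt : G.lower f < G.upper a) :
    G.Pivot a f := by
  have hLa := hT.lower_le a f haf
  have hUa := hT.upper_le a f haf
  refine ⟨fun h => haf.2.1 (h ▸ haf.1), ?_, fun w hw h1 h2 => ⟨?_, ?_⟩, hlt.trans_le hUa, ?_⟩
  · obtain ⟨x, h1, h2⟩ := exists_between hlt
    exact ⟨x, .inl ⟨h1, h2.trans_le hUa⟩, hLa.trans_lt h1, h2⟩
  · refine (hT.tree.closesCycle_of_onCycle haf).mono ?_
    rintro g (hg | rfl)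
    -- The weight of a non-trivial edge is below its upper limit. A trivial edge of the cycle has
    -- weight at most `G.lower f`, as the tree is minimum for the lower limits.
    · rcases (G.lower_le_upper g).lt_or_eq with hgt | hgt
      · exact (lt_upper_of_mem (hw g) hgt).trans_le (hmax g hg)
      · exact (le_upper_of_mem (hw g)).trans_lt
          ((hgt.symm.trans_le (hT.lower_le g f hg)).trans_lt hlt)
    · exact h2
  · obtain ⟨u, v, hl⟩ := G.exists_isLink a
    obtain ⟨X, hX, hcut⟩ := hT.tree.exists_cut hl haf.1
    refine ⟨X, hX, fun g hg hgX => ?_⟩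
    have hag := hcut g hg hgX
    rcases (G.lower_le_upper g).lt_or_eq with hgt | hgt
    · exact (hT.lower_le a g hag).trans_lt (lower_lt_of_mem (hw g) hgt)
    · exact ((hLa.trans_lt hlt).trans_le (hT.upper_le a g hag)).trans_le
        (hgt.symm.trans_le (lower_le_of_mem (hw g)))
  · obtain ⟨u, v, hl⟩ := G.exists_isLink f
    obtain ⟨X, hX, hcut⟩ := haf.exists_cut
    refine Instance.not_eliminated ((hT.tree.closesCycle hl haf.2.1).mono fun g hg =>
      (hT.lower_le g f hg).trans_lt (hlt.trans_le hUa)) hX fun g _ hgX => hlt.trans_le ?_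
    rcases hcut g hgX with rfl | hg
    · exact le_rfl
    · exact hT.upper_le a g hg

/-- The non-tree edge with smallest lower limit in a fundamental cut, and the tree edge of that
cut; this is dual to `Stable.pivot_of_cycle`. -/
theorem Stable.pivot_of_cut (hT : G.Stable T) (hea : OnCycle G.graph T e a)
    (hmin : ∀ g, OnCycle G.graph T e g → G.lower a ≤ G.lower g) (hlt : G.lower a < G.upper e) :
    G.Pivot a e := by
  have hLa := hT.lower_le e a hea
  have hUa := hT.upper_le e a hea
  refine ⟨fun h => hea.2.1 (h ▸ hea.1), ?_, fun w hw h1 h2 => ⟨?_, ?_⟩, hLa.trans_lt hlt, ?_⟩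
  · obtain ⟨x, h1, h2⟩ := exists_between hlt
    exact ⟨x, .inl ⟨hLa.trans_lt h1, h2⟩, h1, h2.trans_le hUa⟩
  · obtain ⟨u, v, hl⟩ := G.exists_isLink a
    refine (hT.tree.closesCycle hl hea.2.1).mono fun g hg => ?_
    rcases (G.lower_le_upper g).lt_or_eq with hgt | hgt
    · exact (lt_upper_of_mem (hw g) hgt).trans_le (hT.upper_le g a hg)
    · exact (le_upper_of_mem (hw g)).trans_lt
        ((hgt.symm.trans_le (hT.lower_le g a hg)).trans_lt (hlt.trans_le hUa))
  · obtain ⟨X, hX, hcut⟩ := hea.exists_cut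
    refine ⟨X, hX, fun g hg hgX => ?_⟩
    rcases hcut g hgX with rfl | heg
    · exact h1
    rcases (G.lower_le_upper g).lt_or_eq with hgt | hgt
    · exact (hmin g heg).trans_lt (lower_lt_of_mem (hw g) hgt)
    · exact (hlt.trans_le (hT.upper_le e g heg)).trans_le
        (hgt.symm.trans_le (lower_le_of_mem (hw g)))
  · obtain ⟨u, v, hl⟩ := G.exists_isLink e
    obtain ⟨X, hX, hcut⟩ := hT.tree.exists_cut hl hea.1
    refine Instance.not_eliminated ((hT.tree.closesCycle_of_onCycle hea).mono ?_) hX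
      fun g hg hgX => (hLa.trans_lt hlt).trans_le (hT.upper_le e g (hcut g hg hgX))
    rintro g (hg | rfl)
    · exact (hT.lower_le g a hg).trans_lt hlt
    · exact hlt

section Finite

variable [Finite E]

theorem exists_max_upper (G : Instance V E) (h : OnCycle G.graph T e f) :
    ∃ a, OnCycle G.graph T a f ∧ ∀ g, OnCycle G.graph T g f → G.upper g ≤ G.upper a :=
  Set.exists_max_image {g | OnCycle G.graph T g f} G.upper (Set.toFinite _) ⟨e, h⟩

theorem exists_min_lower (G : Instance V E) (h : OnCycle G.graph T e f) :
    ∃ a, OnCycle G.graph T e a ∧ ∀ g, OnCycle G.graph T e g → G.lower a ≤ G.lower g :=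
  Set.exists_min_image {g | OnCycle G.graph T e g} G.lower (Set.toFinite _) ⟨f, h⟩

/-- The lexicographic order by lower and then upper limits yields a stable tree, unless some tree
edge with largest upper limit on a fundamental cycle is mandatory in any case. -/
theorem exists_knownMandatory_or_stable (G : Instance V E) :
    (∃ e, G.KnownMandatory e) ∨ ∃ T, G.Stable T := by
  obtain ⟨T, hT, hkey⟩ := exists_isSpanningTree_key_le
    (fun e => toLex (G.lower e, G.upper e)) G.connected
  simp only [Prod.Lex.le_iff, ofLex_toLex] at hkey
  have hlow : ∀ e f, OnCycle G.graph T e f → G.lower e ≤ G.lower f := fun e f h =>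
    (hkey e f h).elim le_of_lt fun h => h.1.le
  by_cases hup : ∀ e f, OnCycle G.graph T e f → G.upper e ≤ G.upper f
  · exact .inr ⟨T, hT, hlow, hup⟩
  push Not at hup
  obtain ⟨e, f, hef, hlt⟩ := hup
  obtain ⟨a, haf, hmax⟩ := G.exists_max_upper hef
  replace hlt := hlt.trans_le (hmax e hef)
  -- Now `G.lower a ≤ G.lower f ≤ G.upper f < G.upper a`.
  refine .inl ⟨a, fun w hw => ⟨(hT.closesCycle_of_onCycle haf).mono ?_, ?_⟩⟩
  · rintro g (hg | rfl)
    · rcases (G.lower_le_upper g).lt_or_eq with hgt | hgt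
      · exact (lt_upper_of_mem (hw g) hgt).trans_le (hmax g hg)
      · exact (le_upper_of_mem (hw g)).trans_lt (((hgt.symm.trans_le (hlow g f hg)).trans
          (G.lower_le_upper f)).trans_lt hlt)
    · exact (le_upper_of_mem (hw g)).trans_lt hlt
  · obtain ⟨u, v, hl⟩ := G.exists_isLink a
    obtain ⟨X, hX, hcut⟩ := hT.exists_cut hl haf.1
    refine ⟨X, hX, fun g hg hgX => ?_⟩
    rcases hkey a g (hcut g hg hgX) with h | ⟨h1, h2⟩
    · exact h.trans_le (lower_le_of_mem (hw g))
    · rw [h1]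
      refine lower_lt_of_mem (hw g) ?_
      linarith [hlow a f haf, G.lower_le_upper f]

end Finite

/-- Such a tree is certified by the predicted weights of all edges but an arbitrary one. -/
theorem Stable.predictionMandatoryFree [Fintype E] [DecidableEq E] (hT : G.Stable T)
    (h1 : ∀ e f, OnCycle G.graph T e f → G.upper e ≤ G.pred f)
    (h2 : ∀ e f, OnCycle G.graph T e f → G.pred e ≤ G.lower f) : G.PredictionMandatoryFree := by
  intro e he
  refine Finset.notMem_erase e Finset.univ (he _ ⟨T, fun w' hw' heq => ?_⟩)
  refine hT.tree.isMST G.exists_isLink fun g f hgf => ?_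
  have heq' : ∀ g, g ≠ e → w' g = G.pred g := fun g hg => heq g (by simp [hg])
  by_cases hg : g = e
  · rw [heq' f (by rintro rfl; exact hgf.2.1 (hg ▸ hgf.1))]
    exact (le_upper_of_mem (hw' g)).trans (h1 g f hgf)
  · rw [heq' g hg]
    exact (h2 g f hgf).trans (lower_le_of_mem (hw' f))

/-! ### The effect of querying the first edge of a pivot -/

/-- What can be done after the answer to the query of `a` in a pivot `a`, `b`. -/
def Continuable (G : Instance V E) (b : E) : Prop :=
  (∃ e, G.KnownMandatory e) ∨ G.Eliminated b ∨ ∃ a, G.Pivot a b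

section Continuation

variable [DecidableEq E]

theorem Pivot.knownMandatory_afterQueries (h : G.Pivot a b) (hv : G.IsRealization v)
    (h1 : G.lower a < v b) (h2 : v b < G.upper a) :
    (G.afterQueries v {b}).KnownMandatory a := by
  intro w hw
  obtain ⟨hw', heq⟩ := hv.of_afterQueries hw
  have hb : w b = v b := heq b (by simp)
  exact (h.inside w hw' (hb ▸ h1) (hb ▸ h2)).afterQueries (by simpa using h.ne.symm)

/-- A stable tree remains stable after a query whose answer keeps the queried edge on its side. -/
theorem Stable.afterQueries (hT : G.Stable T)
    (h1 : ∀ g, OnCycle G.graph T a g → v a ≤ G.lower g)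
    (h2 : ∀ g, OnCycle G.graph T g a → G.upper g ≤ v a)
    (hv : G.IsRealization v) : (G.afterQueries v {a}).Stable T := by
  have ha := lower_le_of_mem (hv a)
  have ha' := le_upper_of_mem (hv a)
  refine ⟨hT.tree, fun e f (hef : OnCycle G.graph T e f) => ?_,
    fun e f (hef : OnCycle G.graph T e f) => ?_⟩
  · have := hT.lower_le e f hef
    simp only [afterQueries_lower, Finset.mem_singleton]
    split_ifs with he hf hf
    · rw [he, hf]
    · subst he; exact h1 f hef
    · subst hf; exact this.trans ha
    · exact this
  · have := hT.upper_le e f hef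
    simp only [afterQueries_upper, Finset.mem_singleton]
    split_ifs with he hf hf
    · rw [he, hf]
    · subst he; exact ha'.trans this
    · subst hf; exact h2 e hef
    · exact this

variable [Finite E]

/-- Unless the weight of `a` makes the first edge `m` of the fundamental cut of `a` mandatory, the
tree remains stable. Then the largest upper limit left on the cycle of `f` either gives a new pivot
or shows that `f` can be deleted. -/
theorem Stable.continuable_of_cycle (hT : G.Stable T) (haf : OnCycle G.graph T a f)
    (hlt : G.lower f < G.upper a) (hv : G.IsRealization v) :
    (G.afterQueries v {a}).Continuable f := by
  have hfa : f ≠ a := fun h => haf.2.1 (h ▸ haf.1)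
  have hUa := hT.upper_le a f haf
  have hnt : G.lower a < G.upper a := (hT.lower_le a f haf).trans_lt hlt
  have hva : v a < G.upper a := lt_upper_of_mem (hv a) hnt
  obtain ⟨m, ham, hmin⟩ := G.exists_min_lower haf
  by_cases hm : G.lower m < v a
  · exact .inl ⟨m, (hT.pivot_of_cut ham hmin (hm.trans hva)).knownMandatory_afterQueries hv hm
      (hva.trans_le (hT.upper_le a m ham))⟩
  have hT' : (G.afterQueries v {a}).Stable T := hT.afterQueries
    (fun g hg => (not_lt.1 hm).trans (hmin g hg)) (fun g hg => absurd haf.1 hg.2.1) hv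
  obtain ⟨a', haf', hmax⟩ := (G.afterQueries v {a}).exists_max_upper haf
  by_cases hlt' : (G.afterQueries v {a}).lower f < (G.afterQueries v {a}).upper a'
  · exact .inr (.inr ⟨a', hT'.pivot_of_cycle haf' hmax hlt'⟩)
  · obtain ⟨u, v', hl⟩ := G.exists_isLink f
    refine .inr (.inl ⟨?_, .inl ((hT.tree.closesCycle hl haf.2.1).mono fun g hg =>
      (hmax g hg).trans (not_lt.1 hlt'))⟩)
    simpa [afterQueries_lower, afterQueries_upper, hfa] using hlt.trans_le hUa

/-- The dual of `Stable.continuable_of_cycle`: otherwise `e` can be contracted. -/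
theorem Stable.continuable_of_cut (hT : G.Stable T) (hea : OnCycle G.graph T e a)
    (hlt : G.lower a < G.upper e) (hv : G.IsRealization v) :
    (G.afterQueries v {a}).Continuable e := by
  have hne : e ≠ a := fun h => hea.2.1 (h ▸ hea.1)
  have hLa := hT.lower_le e a hea
  have hnt : G.lower a < G.upper a := hlt.trans_le (hT.upper_le e a hea)
  have hva : G.lower a < v a := lower_lt_of_mem (hv a) hnt
  obtain ⟨l, hla, hmax⟩ := G.exists_max_upper hea
  by_cases hl : v a < G.upper l
  · exact .inl ⟨l, (hT.pivot_of_cycle hla hmax (hva.trans hl)).knownMandatory_afterQueries hv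
      ((hT.lower_le l a hla).trans_lt hva) hl⟩
  have hT' : (G.afterQueries v {a}).Stable T := hT.afterQueries
    (fun g hg => absurd hg.1 hea.2.1) (fun g hg => (hmax g hg).trans (not_lt.1 hl)) hv
  obtain ⟨a', hea', hmin⟩ := (G.afterQueries v {a}).exists_min_lower hea
  by_cases hlt' : (G.afterQueries v {a}).lower a' < (G.afterQueries v {a}).upper e
  · exact .inr (.inr ⟨a', hT'.pivot_of_cut hea' hmin hlt'⟩)
  · obtain ⟨u, v', hlink⟩ := G.exists_isLink e
    obtain ⟨X, hX, hcut⟩ := hT.tree.exists_cut hlink hea.1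
    refine .inr (.inl ⟨?_, .inr ⟨X, hX, fun g hg hgX =>
      (not_lt.1 hlt').trans (hmin g (hcut g hg hgX))⟩⟩)
    simpa [afterQueries_lower, afterQueries_upper, hne] using hLa.trans_lt hlt

end Continuation

/-- An instance with prediction mandatory edges either has an edge that is mandatory in any case, or
a pivot `a`, `b` whose edge `a` is mandatory according to the predicted weight of `b`. -/
theorem exists_knownMandatory_or_pivot [Fintype E] [DecidableEq E]
    (h : ¬ G.PredictionMandatoryFree) :
    (∃ e, G.KnownMandatory e) ∨ ∃ a b, G.Pivot a b ∧ G.lower a < G.pred b ∧ G.pred b < G.upper a ∧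
      ∀ v, G.IsRealization v → (G.afterQueries v {a}).Continuable b := by
  rcases G.exists_knownMandatory_or_stable with hk | ⟨T, hT⟩
  · exact .inl hk
  refine .inr ?_
  by_cases h1 : ∀ e f, OnCycle G.graph T e f → G.upper e ≤ G.pred f
  · have h2 : ¬ ∀ e f, OnCycle G.graph T e f → G.pred e ≤ G.lower f := fun h2 =>
      h (hT.predictionMandatoryFree h1 h2)
    push Not at h2
    obtain ⟨e, f, hef, hlt⟩ := h2
    obtain ⟨a, hea, hmin⟩ := G.exists_min_lower hef
    have hU := hT.upper_le e a hea
    have hpe : G.pred e ≤ G.upper e := le_upper_of_mem (G.pred_mem e)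
    have hlow : G.lower a < G.pred e := (hmin f hef).trans_lt hlt
    have hnt := (hT.lower_le e a hea).trans_lt (hlow.trans_le hpe)
    exact ⟨a, e, hT.pivot_of_cut hea hmin (hlow.trans_le hpe), hlow,
      (lt_upper_of_mem (G.pred_mem e) hnt).trans_le hU,
      fun v hv => hT.continuable_of_cut hea (hlow.trans_le hpe) hv⟩
  · push Not at h1
    obtain ⟨e, f, hef, hlt⟩ := h1
    obtain ⟨a, haf, hmax⟩ := G.exists_max_upper hef
    have hL := hT.lower_le a f haf
    have hpf : G.lower f ≤ G.pred f := lower_le_of_mem (G.pred_mem f)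
    have hup : G.pred f < G.upper a := hlt.trans_le (hmax e hef)
    have hnt := (hpf.trans_lt hup).trans_le (hT.upper_le a f haf)
    exact ⟨a, f, hT.pivot_of_cycle haf hmax (hpf.trans_lt hup),
      hL.trans_lt (lower_lt_of_mem (G.pred_mem f) hnt), hup,
      fun v hv => hT.continuable_of_cycle haf (hpf.trans_lt hup) hv⟩

end Instance

/-! ### Mispredicted edges -/

namespace Instance

variable {V E : Type*} {G : Instance V E} {w v : E → ℝ} {a b e : E}
  {S A Q : Finset E} {γ c c' : ℕ}

/-- Some relation between `e` and another edge has been predicted incorrectly: the position of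
another edge relative to the interval of `e`, or the position of `e` relative to a non-trivial
interval. Trivial intervals are left out in the second case because an edge that becomes trivial
by a query creates new, possibly incorrect, predicted relations, which are not errors of the given
instance. -/
def Mispredicted (G : Instance V E) (w : E → ℝ) (e : E) : Prop :=
  ∃ e', e' ≠ e ∧ (¬ G.RelationCorrect w e e' ∨
    (G.lower e' < G.upper e' ∧ ¬ G.RelationCorrect w e' e))

theorem Pivot.mispredicted (h : G.Pivot a b) (h1 : G.lower a < G.pred b)
    (h2 : G.pred b < G.upper a) (hw : ¬ (G.lower a < w b ∧ w b < G.upper a)) :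
    G.Mispredicted w a ∧ G.Mispredicted w b := by
  have hn : ¬ G.RelationCorrect w a b := fun hr => hw (hr.2.2 ⟨h1, h2⟩)
  exact ⟨⟨b, h.ne, .inl hn⟩, ⟨a, h.ne.symm, .inr ⟨h.lower_lt_upper_left, hn⟩⟩⟩

variable [DecidableEq E]

/-- Queries create no new mispredicted non-trivial edges. -/
theorem Mispredicted.of_afterQueries (h : (G.afterQueries w S).Mispredicted w e) (he : e ∉ S) :
    G.Mispredicted w e := by
  obtain ⟨e', hne, h⟩ := h
  refine ⟨e', hne, ?_⟩
  by_cases he' : e' ∈ S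
  · refine absurd h (not_or.2 ⟨not_not.2 ?_, fun h => (notMem_of_lower_lt h.1).1 he'⟩)
    simp [RelationCorrect, afterQueries_pred, he']
  · simpa [RelationCorrect, afterQueries_pred, afterQueries_lower, afterQueries_upper, he, he']
      using h

variable [Fintype E]

theorem Mispredicted.one_le (h : G.Mispredicted w e) : 1 ≤ G.kPlus w e + G.kMinus w e := by
  obtain ⟨e', hne, h⟩ := h
  have hmem : e' ∈ Finset.univ.erase e := by simp [hne]
  rcases h with h | ⟨-, h⟩
  · have := Finset.single_le_sum (f := fun e' => G.hop w e e') (fun _ _ => Nat.zero_le _) hmem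
    simp only [hop, h, if_false] at this
    unfold kMinus hop
    omega
  · have := Finset.single_le_sum (f := fun e' => G.hop w e' e) (fun _ _ => Nat.zero_le _) hmem
    simp only [hop, h, if_false] at this
    unfold kPlus hop
    omega

/-! ### Charging queries -/

open Classical in
/-- The queried edges and the edges that can be deleted or contracted because of the queries. -/
noncomputable def gain (G : Instance V E) (w : E → ℝ) (A : Finset E) : Finset E :=
  Finset.univ.filter fun e => e ∈ A ∨ ((G.afterQueries w A).Eliminated e ∧ ¬ G.Eliminated e)

theorem mem_gain : e ∈ G.gain w A ↔
    e ∈ A ∨ ((G.afterQueries w A).Eliminated e ∧ ¬ G.Eliminated e) := by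
  simp [gain]

open Classical in
/-- The query set `A` meets both bounds when up to `c` of the queries need not be paid for in the
second bound; the `γ - 2 - c` such queries that have been made before are a surplus in the first
bound. -/
structure Good (γ c : ℕ) (G : Instance V E) (w : E → ℝ) (A : Finset E) : Prop where
  free : (G.afterQueries w A).PredictionMandatoryFree
  nontrivial : ∀ e ∈ A, G.lower e < G.upper e
  not_eliminated : ∀ e ∈ A, ¬ G.Eliminated e
  robust : ∀ Q, G.Feasible w Q → A.card ≤ γ * (G.gain w A ∩ Q).card + c
  consistent : ∀ Q, G.Feasible w Q → γ * A.card + c + 2 ≤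
    (γ + 1) * ((G.gain w A ∩ Q).card + (A.filter (G.Mispredicted w)).card) + γ

/-- What the queries `S` have to achieve for each feasible query set in order to turn `c` free
queries into `c'` free queries. The set `P` consists of the edges to which the queries are charged,
and `R` of mispredicted ones. -/
def Pays (γ c c' : ℕ) (G : Instance V E) (w : E → ℝ) (S : Finset E) : Prop :=
  ∀ Q, G.Feasible w Q → ∃ P R : Finset E, P ⊆ G.gain w S ∩ Q ∧ R ⊆ S ∧
    (∀ e ∈ R, G.Mispredicted w e) ∧ S.card + c' ≤ γ * P.card + c ∧
    γ * S.card + c ≤ (γ + 1) * (P.card + R.card) + c'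

/-- Queries `S` that pay for themselves can be put before good queries `A` of the remaining
instance: what `S` is charged to and the gain of `A` in the remaining instance are disjoint. -/
theorem Good.union (hA : Good γ c' (G.afterQueries w S) w A) (hw : G.IsRealization w)
    (hS : ∀ e ∈ S, G.lower e < G.upper e ∧ ¬ G.Eliminated e) (hpay : G.Pays γ c c' w S) :
    Good γ c G w (S ∪ A) := by
  classical
  have hdisj : Disjoint S A := Finset.disjoint_right.2 fun e he =>
    (notMem_of_lower_lt (hA.nontrivial e he)).1
  have hcard : (S ∪ A).card = S.card + A.card := Finset.card_union_of_disjoint hdisj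
  have hgain : ∀ Q, (G.gain w S ∩ Q).card + ((G.afterQueries w S).gain w A ∩ Q).card ≤
      (G.gain w (S ∪ A) ∩ Q).card := by
    intro Q
    rw [← Finset.card_union_of_disjoint]
    · refine Finset.card_le_card ?_
      rw [← Finset.union_inter_distrib_right]
      refine Finset.inter_subset_inter_right (Finset.union_subset ?_ ?_)
      · intro e he
        rw [mem_gain] at he ⊢
        by_cases heSA : e ∈ S ∪ A
        · exact .inl heSA
        rw [Finset.mem_union, not_or] at heSA
        obtain ⟨h1, h2⟩ := he.resolve_left heSA.1
        have := h1.afterQueries hw.afterQueries heSA.2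
        rw [afterQueries_afterQueries] at this
        exact .inr ⟨this, h2⟩
      · intro e he
        rw [mem_gain, afterQueries_afterQueries] at he
        rw [mem_gain]
        rcases he with he | ⟨h1, h2⟩
        · exact .inl (Finset.mem_union_right _ he)
        · by_cases heS : e ∈ S
          · exact .inl (Finset.mem_union_left _ heS)
          · exact .inr ⟨h1, fun h => h2 (h.afterQueries hw heS)⟩
    · refine (Finset.disjoint_left.2 fun e he he' => ?_).mono Finset.inter_subset_left
        Finset.inter_subset_left
      rw [mem_gain] at he he'
      have hnt : (G.afterQueries w S).lower e < (G.afterQueries w S).upper e := by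
        rcases he' with h | ⟨h, -⟩
        · exact hA.nontrivial e h
        · exact (notMem_of_lower_lt h.1).2
      obtain ⟨h1, -⟩ := he.resolve_left (notMem_of_lower_lt hnt).1
      rcases he' with h | ⟨-, h⟩
      · exact hA.not_eliminated e h h1
      · exact h h1
  refine ⟨?_, fun e he => ?_, fun e he => ?_, fun Q hQ => ?_, fun Q hQ => ?_⟩
  · have := hA.free
    rwa [afterQueries_afterQueries] at this
  · rcases Finset.mem_union.1 he with he | he
    · exact (hS e he).1
    · exact (notMem_of_lower_lt (hA.nontrivial e he)).2
  · rcases Finset.mem_union.1 he with he | he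
    · exact (hS e he).2
    · exact fun h => hA.not_eliminated e he
        (h.afterQueries hw (notMem_of_lower_lt (hA.nontrivial e he)).1)
  · obtain ⟨P, R, hP, -, -, h1, -⟩ := hpay Q hQ
    have h2 := hA.robust Q (hQ.afterQueries hw)
    have h3 := Nat.mul_le_mul_left γ ((Nat.add_le_add_right (Finset.card_le_card hP) _).trans
      (hgain Q))
    rw [mul_add] at h3
    omega
  · obtain ⟨P, R, hP, hRS, hR, -, h1⟩ := hpay Q hQ
    have h2 := hA.consistent Q (hQ.afterQueries hw)
    have h3 := (Nat.add_le_add_right (Finset.card_le_card hP) _).trans (hgain Q)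
    have h4 : R.card + (A.filter ((G.afterQueries w S).Mispredicted w)).card ≤
        ((S ∪ A).filter (G.Mispredicted w)).card := by
      rw [← Finset.card_union_of_disjoint
        (hdisj.mono hRS (Finset.filter_subset _ _))]
      refine Finset.card_le_card fun e he => ?_
      rw [Finset.mem_filter]
      rcases Finset.mem_union.1 he with he | he
      · exact ⟨Finset.mem_union_left _ (hRS he), hR e he⟩
      · rw [Finset.mem_filter] at he
        exact ⟨Finset.mem_union_right _ he.1,
          he.2.of_afterQueries (Finset.disjoint_right.1 hdisj he.1)⟩
    have h5 := Nat.mul_le_mul_left (γ + 1) (Nat.add_le_add h3 h4)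
    simp only [mul_add] at h1 h2 h5 ⊢
    rw [hcard, mul_add]
    omega

/-! ### Strategies -/

/-- When the edges of `S` have been queried with the answers `v`, some strategy for the remaining
queries makes all queries together good. -/
def WinsFrom (γ c : ℕ) (G : Instance V E) (v : E → ℝ) (S : Finset E) : Prop :=
  ∃ s : Strategy E, ∀ w, G.IsRealization w → (∀ e ∈ S, w e = v e) →
    Good γ c G w (S ∪ s.queried w)

/-- Some strategy leads to good queries from the start. -/
def Wins (γ c : ℕ) (G : Instance V E) : Prop :=
  ∃ s : Strategy E, ∀ w, G.IsRealization w → Good γ c G w (s.queried w)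

theorem WinsFrom.wins (h : WinsFrom γ c G v ∅) : Wins γ c G := by
  obtain ⟨s, hs⟩ := h
  exact ⟨s, fun w hw => by simpa using hs w hw (by simp)⟩

theorem winsFrom_of_query (a : E) (ha : a ∉ S) (hv : G.IsRealization v)
    (h : ∀ v', G.IsRealization v' → (∀ e ∈ S, v' e = v e) → WinsFrom γ c G v' (insert a S)) :
    WinsFrom γ c G v S := by
  have h' : ∀ x, ∃ s : Strategy E, x ∈ G.interval a → ∀ w, G.IsRealization w →
      (∀ e ∈ S, w e = v e) → w a = x → Good γ c G w (insert a S ∪ s.queried w) := by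
    intro x
    by_cases hx : x ∈ G.interval a
    · obtain ⟨s, hs⟩ := h (Function.update v a x) (fun g => by
        by_cases hg : g = a
        · subst hg; rwa [Function.update_self]
        · rw [Function.update_of_ne hg]; exact hv g)
        (fun e he => Function.update_of_ne (by rintro rfl; exact ha he) _ _)
      refine ⟨s, fun _ w hw hS hwa => hs w hw fun e he => ?_⟩
      rcases Finset.mem_insert.1 he with rfl | he
      · rw [Function.update_self, hwa]
      · rw [Function.update_of_ne (ne_of_mem_of_not_mem he ha), hS e he]
    · exact ⟨.halt, fun h => absurd h hx⟩
  choose next hnext using h'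
  refine ⟨.query a next, fun w hw hS => ?_⟩
  have := hnext (w a) (hw a) w hw hS rfl
  rwa [Finset.insert_union, ← Finset.union_insert] at this

theorem winsFrom_of_pays (hS : ∀ e ∈ S, G.lower e < G.upper e ∧ ¬ G.Eliminated e)
    (hpay : ∀ w, G.IsRealization w → (∀ e ∈ S, w e = v e) → G.Pays γ c c' w S)
    (h : Wins γ c' (G.afterQueries v S)) : WinsFrom γ c G v S := by
  obtain ⟨s, hs⟩ := h
  refine ⟨s, fun w hw heq => ?_⟩
  rw [← afterQueries_congr heq] at hs
  exact (hs w hw.afterQueries).union hw hS (hpay w hw heq)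

/-- The number of non-trivial edges. -/
noncomputable def nontrivialCount (G : Instance V E) : ℕ :=
  {e | G.lower e < G.upper e}.ncard

theorem nontrivialCount_afterQueries_lt (he : e ∈ S) (h : G.lower e < G.upper e) :
    (G.afterQueries w S).nontrivialCount < G.nontrivialCount := by
  refine Set.ncard_lt_ncard ⟨fun g hg => (notMem_of_lower_lt hg).2, fun hs => ?_⟩
  exact (notMem_of_lower_lt (hs h)).1 he

theorem subset_gain_inter {P : Finset E} (h : ∀ e ∈ P, e ∈ S ∧ e ∈ Q) :
    P ⊆ G.gain w S ∩ Q := fun e he =>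
  Finset.mem_inter.2 ⟨mem_gain.2 (.inl (h e he).1), (h e he).2⟩

/-! ### Rounds of queries -/

section Rounds

theorem wins_of_knownMandatory (hγ : 2 ≤ γ)
    (ih : ∀ G' : Instance V E, G'.nontrivialCount < G.nontrivialCount → ∀ c ≤ γ - 2, Wins γ c G')
    (hc : c ≤ γ - 2) (ha : G.KnownMandatory a) : Wins γ c G := by
  obtain ⟨v, hv⟩ := G.exists_isRealization
  refine (winsFrom_of_query a (Finset.notMem_empty a) hv fun v hv _ => ?_).wins
  refine winsFrom_of_pays (c' := c) ?_ (fun w hw _ Q hQ => ⟨{a}, ∅, ?_, ?_⟩)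
    (ih _ (nontrivialCount_afterQueries_lt (Finset.mem_insert_self a _) (ha v hv).lower_lt_upper) c
      hc)
  · simpa using ⟨(ha v hv).lower_lt_upper, (ha v hv).not_eliminated hv⟩
  · exact subset_gain_inter (by simpa using (ha w hw).mem_of_feasible hw hQ)
  · simp
    omega

theorem Pivot.wins_of_free
    (ih : ∀ G' : Instance V E, G'.nontrivialCount < G.nontrivialCount → ∀ c ≤ γ - 2, Wins γ c G')
    (hc : c + 1 ≤ γ - 2) (h : G.Pivot a b) (h1 : G.lower a < G.pred b)
    (h2 : G.pred b < G.upper a) : Wins γ (c + 1) G := by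
  obtain ⟨v, hv⟩ := G.exists_isRealization
  refine (winsFrom_of_query a (Finset.notMem_empty a) hv fun v hv _ => ?_).wins
  refine winsFrom_of_pays (c' := c) ?_ (fun w hw _ Q hQ => ?_)
    (ih _ (nontrivialCount_afterQueries_lt (Finset.mem_insert_self a _) h.lower_lt_upper_left) c
      (by omega))
  · simpa using ⟨h.lower_lt_upper_left, h.not_eliminated_left hv⟩
  by_cases hb : G.lower a < w b ∧ w b < G.upper a
  · refine ⟨{a}, ∅, subset_gain_inter ?_, by simp, by simp, ?_⟩
    · simpa using (h.inside w hw hb.1 hb.2).mem_of_feasible hw hQ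
    · simp
      omega
  · refine ⟨∅, {a}, by simp, by simp, by simpa using (h.mispredicted h1 h2 hb).1, ?_⟩
    simp
    omega

/-- A round that starts when no free queries are left and after which `γ - 2` of them are available
again. -/
theorem Pivot.wins_of_continuable (hγ : 2 ≤ γ)
    (ih : ∀ G' : Instance V E, G'.nontrivialCount < G.nontrivialCount → ∀ c ≤ γ - 2, Wins γ c G')
    (h : G.Pivot a b) (h1 : G.lower a < G.pred b)
    (h2 : G.pred b < G.upper a)
    (hcont : ∀ v, G.IsRealization v → (G.afterQueries v {a}).Continuable b) : Wins γ 0 G := by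
  obtain ⟨v, hv⟩ := G.exists_isRealization
  have hna := h.not_eliminated_left hv
  have hla := h.lower_lt_upper_left
  refine (winsFrom_of_query a (Finset.notMem_empty a) hv fun v hv _ => ?_).wins
  have hwins : ∀ (v : E → ℝ) S, a ∈ S → Wins γ (γ - 2) (G.afterQueries v S) := fun v S hS =>
    ih _ (nontrivialCount_afterQueries_lt hS hla) _ le_rfl
  have hin : ∀ w, G.IsRealization w → G.lower a < w b → w b < G.upper a →
      ∀ Q, G.Feasible w Q → a ∈ Q := fun w hw h1 h2 Q hQ =>
    (h.inside w hw h1 h2).mem_of_feasible hw hQ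
  rcases hcont v hv with ⟨e, he⟩ | hb | ⟨a', h'⟩
  -- A new edge `e` is mandatory in any case.
  · have hev := he v hv.afterQueries
    obtain ⟨hea, hle⟩ := notMem_of_lower_lt hev.lower_lt_upper
    have hne : ¬ G.Eliminated e := fun hE =>
      hev.not_eliminated hv.afterQueries (hE.afterQueries hv hea)
    rw [Finset.mem_singleton] at hea
    refine winsFrom_of_query e (by simpa using hea) hv fun v' hv' heq => ?_
    refine winsFrom_of_pays (c' := γ - 2) ?_ (fun w hw hwv Q hQ => ?_)
      (hwins _ _ (by simp))
    · simpa using ⟨⟨hle, hne⟩, hla, hna⟩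
    have heQ : e ∈ Q := by
      have hag : G.afterQueries w {a} = G.afterQueries v {a} := afterQueries_congr fun g hg => by
        rw [Finset.mem_singleton] at hg
        subst hg
        rw [hwv g (by simp), heq g (by simp)]
      have hw' : (G.afterQueries w {a}).IsRealization w := hw.afterQueries
      have hQ' : (G.afterQueries w {a}).Feasible w Q := hQ.afterQueries hw
      rw [hag] at hw' hQ'
      exact (he w hw').mem_of_feasible hw' hQ'
    by_cases hb : G.lower a < w b ∧ w b < G.upper a
    · refine ⟨{e, a}, ∅, subset_gain_inter ?_, by simp, by simp, ?_⟩
      · simpa [heQ] using hin w hw hb.1 hb.2 Q hQ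
      · simp [Finset.card_pair hea]
        omega
    · refine ⟨{e}, {a}, subset_gain_inter (by simpa using heQ), by simp,
        by simpa using (h.mispredicted h1 h2 hb).1, ?_⟩
      simp [Finset.card_pair hea]
      omega
  -- The edge `b` can be deleted or contracted, and is charged if `a` is not optimal.
  · refine winsFrom_of_pays (c' := γ - 2) ?_ (fun w hw hwv Q hQ => ?_) (hwins _ _ (by simp))
    · simpa using ⟨hla, hna⟩
    have hbw : (G.afterQueries w {a}).Eliminated b := by
      rwa [afterQueries_congr (v := v) fun e he => hwv e (by simpa using he)]
    rcases h.mem_or_mem hw hQ with ha | hbQ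
    · refine ⟨{a}, ∅, subset_gain_inter (by simpa using ha), by simp, by simp, ?_⟩
      simp
      omega
    · refine ⟨{b}, ∅, ?_, by simp, by simp, ?_⟩
      · simpa [mem_gain, hbQ] using .inr ⟨hbw, h.not_eliminated⟩
      · simp
        omega
  -- There is a new pivot `a'`, `b`; what comes next depends on the weight of `b`.
  · refine winsFrom_of_query b (by simpa using h.ne) hv fun v' hv' heq => ?_
    by_cases hb : G.lower a < v' b ∧ v' b < G.upper a
    · obtain ⟨ha'a, hla'⟩ := notMem_of_lower_lt h'.lower_lt_upper_left
      have hna' : ¬ G.Eliminated a' := fun hE =>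
        h'.not_eliminated_left hv.afterQueries (hE.afterQueries hv ha'a)
      rw [Finset.mem_singleton] at ha'a
      have hcard : (insert a' (insert b (insert a ∅)) : Finset E).card = 3 :=
        Finset.card_eq_three.2 ⟨a', b, a, h'.ne.symm, ha'a, h.ne, rfl⟩
      refine winsFrom_of_query a' (by simpa using ⟨h'.ne.symm, ha'a⟩) hv'
        fun v'' hv'' heq' => ?_
      refine winsFrom_of_pays (c' := γ - 2) ?_ (fun w hw hwv Q hQ => ?_)
        (hwins _ _ (by simp))
      · simpa using ⟨⟨hla', hna'⟩, ⟨h.lower_lt_upper, h.not_eliminated⟩, hla, hna⟩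
      have hwb : w b = v' b := by rw [hwv b (by simp), heq' b (by simp)]
      have haQ := hin w hw (hwb ▸ hb.1) (hwb ▸ hb.2) Q hQ
      have hag : G.afterQueries w {a} = G.afterQueries v {a} := afterQueries_congr fun g hg => by
        rw [Finset.mem_singleton] at hg
        subst hg
        rw [hwv g (by simp), heq' g (by simp), heq g (by simp)]
      rw [← hag] at h'
      obtain ⟨p, hpS, hpa, hpQ⟩ : ∃ p, (p = a' ∨ p = b) ∧ p ≠ a ∧ p ∈ Q := by
        rcases h'.mem_or_mem hw.afterQueries (hQ.afterQueries hw) with hQ' | hQ'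
        · exact ⟨a', .inl rfl, ha'a, hQ'⟩
        · exact ⟨b, .inr rfl, h.ne, hQ'⟩
      refine ⟨{p, a}, ∅, subset_gain_inter ?_, by simp, by simp, ?_⟩
      · intro g hg
        simp only [Finset.mem_insert, Finset.mem_singleton] at hg ⊢
        rcases hg with rfl | rfl
        · exact ⟨by tauto, hpQ⟩
        · exact ⟨by simp, haQ⟩
      · simp only [hcard, Finset.card_pair hpa, Finset.card_empty]
        omega
    · refine winsFrom_of_pays (c' := γ - 2) ?_ (fun w hw hwv Q hQ => ?_)
        (hwins _ _ (by simp))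
      · simpa using ⟨⟨h.lower_lt_upper, h.not_eliminated⟩, hla, hna⟩
      have hm := h.mispredicted h1 h2 (w := w) (by rwa [hwv b (by simp)])
      obtain ⟨p, hpS, hpQ⟩ : ∃ p, (p = a ∨ p = b) ∧ p ∈ Q := by
        rcases h.mem_or_mem hw hQ with hQ' | hQ'
        · exact ⟨a, .inl rfl, hQ'⟩
        · exact ⟨b, .inr rfl, hQ'⟩
      refine ⟨{p}, {b, a}, subset_gain_inter ?_, by simp, by simpa using hm.symm, ?_⟩
      · simpa [hpQ] using hpS.symm
      · simp [Finset.card_pair h.ne]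
        omega

end Rounds

theorem wins (hγ : 2 ≤ γ) (G : Instance V E) (hc : c ≤ γ - 2) : Wins γ c G := by
  induction hn : G.nontrivialCount using Nat.strong_induction_on generalizing G c with
  | _ n ih =>
    subst hn
    have ih' : ∀ G' : Instance V E, G'.nontrivialCount < G.nontrivialCount →
        ∀ c ≤ γ - 2, Wins γ c G' := fun G' hlt c hc => ih _ hlt G' hc rfl
    by_cases hfree : G.PredictionMandatoryFree
    · refine ⟨.halt, fun w _ => ⟨by simpa [Strategy.queried, afterQueries_empty] using hfree,
        by simp [Strategy.queried], by simp [Strategy.queried], by simp [Strategy.queried], ?_⟩⟩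
      intro Q _
      simp [Strategy.queried]
      omega
    rcases exists_knownMandatory_or_pivot hfree with ⟨e, he⟩ | ⟨a, b, h, h1, h2, hcont⟩
    · exact wins_of_knownMandatory hγ ih' hc he
    · cases c with
      | zero => exact h.wins_of_continuable hγ ih' h1 h2 hcont
      | succ c => exact h.wins_of_free ih' hc h1 h2

end Instance

end MSTUncertainty

theorem mainTheorem4 (γ : ℕ) (hγ : 2 ≤ γ) :
    ∃ A : MSTUncertainty.QueryAlgorithm.{u, v},
      ∀ (V : Type u) (E : Type v) [Finite V] [Fintype E] [DecidableEq E]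
        (G : MSTUncertainty.Instance V E) (w : E → ℝ), G.IsRealization w →
        ∀ ALG : Finset E, ALG = (A V E G).queried w →
          (G.afterQueries w ALG).PredictionMandatoryFree ∧
          ∃ D : Finset E, Disjoint D ALG ∧
            (∀ e ∈ D, (G.afterQueries w ALG).Eliminated e) ∧
            ∀ OPT : Finset E, G.IsOptimal w OPT →
              (ALG.card : ℝ) ≤
                min ((1 + 1 / (γ : ℝ)) *
                      ((((ALG ∪ D) ∩ OPT).card : ℝ) +
                        ((∑ e ∈ ALG, G.kPlus w e : ℕ) : ℝ) +
                        ((∑ e ∈ ALG, G.kMinus w e : ℕ) : ℝ)))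
                    ((γ : ℝ) * (((ALG ∪ D) ∩ OPT).card : ℝ) + (γ : ℝ) - 2) := by
  classical
  refine ⟨fun V E _ _ _ G => (MSTUncertainty.Instance.wins hγ G le_rfl).choose, ?_⟩
  intro V E _ _ _ G w hw ALG hALG
  have hgood := (MSTUncertainty.Instance.wins hγ G le_rfl).choose_spec w hw
  rw [← hALG] at hgood
  refine ⟨hgood.free, Finset.univ.filter fun e =>
    e ∉ ALG ∧ (G.afterQueries w ALG).Eliminated e, ?_, by simp, fun OPT hOPT => ?_⟩
  · exact Finset.disjoint_left.2 fun e he => (Finset.mem_filter.1 he).2.1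
  set D := Finset.univ.filter fun e => e ∉ ALG ∧ (G.afterQueries w ALG).Eliminated e with hD
  have hgain : (G.gain w ALG ∩ OPT).card ≤ ((ALG ∪ D) ∩ OPT).card := by
    refine Finset.card_le_card (Finset.inter_subset_inter_right fun e he => ?_)
    by_cases heA : e ∈ ALG
    · exact Finset.mem_union_left _ heA
    · exact Finset.mem_union_right _ (Finset.mem_filter.2
        ⟨Finset.mem_univ e, heA, ((MSTUncertainty.Instance.mem_gain.1 he).resolve_left heA).1⟩)
  have herr : (ALG.filter (G.Mispredicted w)).card ≤
      ∑ e ∈ ALG, G.kPlus w e + ∑ e ∈ ALG, G.kMinus w e := by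
    rw [← Finset.sum_add_distrib, Finset.card_filter]
    refine Finset.sum_le_sum fun e _ => ?_
    split_ifs with h
    · exact h.one_le
    · exact Nat.zero_le _
  have hrob := (hgood.robust OPT hOPT.1).trans
    (Nat.add_le_add_right (Nat.mul_le_mul_left γ hgain) _)
  have hcons := (hgood.consistent OPT hOPT.1).trans
    (Nat.add_le_add_right (Nat.mul_le_mul_left (γ + 1) (Nat.add_le_add hgain herr)) _)
  have hcons' : γ * ALG.card ≤ (γ + 1) * (((ALG ∪ D) ∩ OPT).card +
      (∑ e ∈ ALG, G.kPlus w e + ∑ e ∈ ALG, G.kMinus w e)) := by omega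
  have hγ0 : (0 : ℝ) < γ := by exact_mod_cast (by omega : 0 < γ)
  refine le_min ?_ ?_
  · have h : (γ : ℝ) * ALG.card ≤ (γ + 1) * ((((ALG ∪ D) ∩ OPT).card : ℝ) +
        (((∑ e ∈ ALG, G.kPlus w e : ℕ) : ℝ) + ((∑ e ∈ ALG, G.kMinus w e : ℕ) : ℝ))) := by
      exact_mod_cast hcons'
    rw [one_add_div hγ0.ne', div_mul_eq_mul_div, le_div_iff₀ hγ0]
    linarith
  · have h : (ALG.card : ℝ) ≤ γ * (((ALG ∪ D) ∩ OPT).card : ℝ) + ((γ - 2 : ℕ) : ℝ) := by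
      exact_mod_cast hrob
    rw [Nat.cast_sub hγ] at h
    push_cast at h
    linarith
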